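/- **Theorem 3.1 (coupled differential-difference equations).** Let $\lambda>-1$, and for $t>0$ let $$w(x;t)=x^{\lambda}e^{-x^3-t/x},\qquad x\in(0,\infty).$$ Let $P_n(x;t)$, $n=0,1,2,\ldots$, be the monic polynomials with $\deg P_n=n$ that are orthogonal with respect to this weight, i.e. $\int_0^\infty P_m(x;t)P_n(x;t)w(x;t)\,dx=h_n(t)\delta_{mn}$ with $h_n(t)>0$, and let $\alpha_n(t)$ and $\beta_n(t)$ be the coefficients of their three-term recurrence relation $$xP_n(x;t)=P_{n+1}(x;t)+\alpha_n(t)P_n(x;t)+\beta_n(t)P_{n-1}(x;t),\qquad n\ge 0,\qquad \beta_0(t):=0 .$$ (Quantities with a negative index, which occur below only multiplied by $\beta_0=0$, are taken to be $0$.) Then for every $n\ge 0$ the functions $\alpha_n$ and $\beta_n$ are differentiable on $(0,\infty)$ and, for all $t>0$, $$t\alpha_n'=\alpha_n+3\beta_n\left(\alpha_n^2+\alpha_n\alpha_{n-1}+\alpha_{n-1}^2+\beta_n+\beta_{n-1}\right)-3\beta_{n+1}\left(\alpha_{n+1}^2+\alpha_{n+1}\alpha_n+\alpha_n^2+\beta_{n+2}+\beta_{n+1}\right),$$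 $$t\beta_n'=\beta_n\left[2+3\alpha_{n-2}\beta_{n-1}-3\alpha_{n+1}\beta_{n+1}+3\alpha_{n-1}\left(\alpha_{n-1}^2+\beta_n+2\beta_{n-1}\right)-3\alpha_n\left(\alpha_n^2+\beta_n+2\beta_{n+1}\right)\right].$$ -/

import Mathlib

namespace SingularAiry

open MeasureTheory Set Polynomial

noncomputable section

/-- The singularly perturbed Airy weight `w(x;t) = x^lam * exp (-x^3 - t/x)`, used on `(0, ∞)`. -/
def weight (lam t x : ℝ) : ℝ := x ^ lam * Real.exp (-x ^ 3 - t / x)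

/-- The pairing `∫_0^∞ p(x) q(x) w(x;t) dx` of two polynomials. -/
def pairing (lam t : ℝ) (p q : ℝ[X]) : ℝ :=
  ∫ x in Ioi (0 : ℝ), p.eval x * q.eval x * weight lam t x

/-- The monic orthogonal polynomials `P_n(x;t)` of the weight, by the Gram–Schmidt process applied
to the monomials: `P_n = x^n - ∑_{k<n} (⟨x^n, P_k⟩ / ⟨P_k, P_k⟩) P_k`. -/
def orthoPoly (lam t : ℝ) (n : ℕ) : ℝ[X] :=
  X ^ n - ∑ k : Fin n, C (pairing lam t (X ^ n) (orthoPoly lam t k) /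
    pairing lam t (orthoPoly lam t k) (orthoPoly lam t k)) * orthoPoly lam t k
termination_by n
decreasing_by all_goals exact k.2

/-- The squared norms `h_n(t) = ∫_0^∞ P_n(x;t)^2 w(x;t) dx`. -/
def normSq (lam : ℝ) (n : ℕ) (t : ℝ) : ℝ :=
  pairing lam t (orthoPoly lam t n) (orthoPoly lam t n)

/-- The recurrence coefficients `α_n(t)`, `n ≥ 0`, with the convention `α_n = 0` for `n < 0`.
For `n ≥ 0` they are given by the usual integral `(1/h_n) ∫ x P_n^2 w dx`; the three-term
recurrence relation itself is proved below. -/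
def alpha (lam : ℝ) : ℤ → ℝ → ℝ
  | Int.ofNat n, t =>
      pairing lam t (X * orthoPoly lam t n) (orthoPoly lam t n) / normSq lam n t
  | Int.negSucc _, _ => 0

/-- The recurrence coefficients `β_n(t)`, `n ≥ 0`, with `β_0 = 0` and the convention `β_n = 0` for
`n < 0`. For `n ≥ 1` they are given by `(1/h_{n-1}) ∫ x P_n P_{n-1} w dx`; the three-term
recurrence relation itself is proved below. -/
def beta (lam : ℝ) : ℤ → ℝ → ℝ
  | Int.ofNat 0, _ => 0
  | Int.ofNat (n + 1), t =>
      pairing lam t (X * orthoPoly lam t (n + 1)) (orthoPoly lam t n) / normSq lam n t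
  | Int.negSucc _, _ => 0

/-! Well-posedness: the polynomials above are monic and orthogonal with `h_n > 0`, they are the only
such polynomials, and `α_n`, `β_n` are the coefficients of their three-term recurrence relation. -/

section Basic

variable {lam t : ℝ}

theorem weight_pos {x : ℝ} (hx : 0 < x) : 0 < weight lam t x :=
  mul_pos (Real.rpow_pos_of_pos hx _) (Real.exp_pos _)

theorem integrableOn_pow_mul_weight (hlam : -1 < lam) (ht : 0 < t) (k : ℕ) :
    IntegrableOn (fun x : ℝ => x ^ k * weight lam t x) (Ioi 0) := by
  have h := integrableOn_rpow_mul_exp_neg_mul_rpow (p := 3) (s := lam + k) (b := 1)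
    (by have : (0 : ℝ) ≤ k := k.cast_nonneg
        linarith) (by norm_num) one_pos
  refine Integrable.mono' h ?_ ?_
  · unfold weight
    exact Measurable.aestronglyMeasurable (by fun_prop)
  · refine (ae_restrict_iff' measurableSet_Ioi).2 (Filter.Eventually.of_forall fun x hx => ?_)
    have hx : 0 < x := hx
    rw [Real.norm_of_nonneg (mul_nonneg (pow_nonneg hx.le _) (weight_pos hx).le), weight,
      ← mul_assoc, Real.rpow_add hx, Real.rpow_natCast, mul_comm (x ^ k)]
    refine mul_le_mul_of_nonneg_left (Real.exp_le_exp.2 ?_) (by positivity)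
    have h1 : 0 < t / x := div_pos ht hx
    have h2 : x ^ (3 : ℝ) = x ^ 3 := by exact_mod_cast Real.rpow_natCast x 3
    rw [h2]
    linarith

theorem integrableOn_eval_mul_weight (hlam : -1 < lam) (ht : 0 < t) (p : ℝ[X]) :
    IntegrableOn (fun x : ℝ => p.eval x * weight lam t x) (Ioi 0) := by
  induction p using Polynomial.induction_on' with
  | add p q hp hq =>
    refine (hp.add hq).congr (Filter.Eventually.of_forall fun x => ?_)
    simp [add_mul]
  | monomial k a =>
    refine ((integrableOn_pow_mul_weight hlam ht k).const_mul a).congr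
      (Filter.Eventually.of_forall fun x => ?_)
    simp [mul_assoc]

theorem integrableOn_mul (hlam : -1 < lam) (ht : 0 < t) (p q : ℝ[X]) :
    IntegrableOn (fun x : ℝ => p.eval x * q.eval x * weight lam t x) (Ioi 0) := by
  simpa using integrableOn_eval_mul_weight hlam ht (p * q)

theorem pairing_comm (p q : ℝ[X]) : pairing lam t p q = pairing lam t q p := by
  simp only [pairing, mul_comm]

theorem pairing_X_mul (p q : ℝ[X]) : pairing lam t (X * p) q = pairing lam t p (X * q) := by
  simp only [pairing, eval_mul, eval_X]
  congr 1; ext x; ring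

theorem pairing_C_mul (a : ℝ) (p q : ℝ[X]) : pairing lam t (C a * p) q = a * pairing lam t p q := by
  simp only [pairing, eval_mul, eval_C, mul_assoc, integral_const_mul]

theorem degree_C_mul_le (a : ℝ) (p : ℝ[X]) : (C a * p).degree ≤ p.degree := by
  rw [← smul_eq_C_mul]
  exact degree_smul_le a p

theorem pairing_sub (hlam : -1 < lam) (ht : 0 < t) (p q r : ℝ[X]) :
    pairing lam t (p - q) r = pairing lam t p r - pairing lam t q r := by
  simp only [pairing, eval_sub, sub_mul]
  exact integral_sub (integrableOn_mul hlam ht p r) (integrableOn_mul hlam ht q r)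

theorem pairing_sum (hlam : -1 < lam) (ht : 0 < t) {ι : Type} (s : Finset ι) (f : ι → ℝ[X])
    (r : ℝ[X]) : pairing lam t (∑ i ∈ s, f i) r = ∑ i ∈ s, pairing lam t (f i) r := by
  simp only [pairing, eval_finsetSum, Finset.sum_mul]
  exact integral_finsetSum _ fun i _ => integrableOn_mul hlam ht (f i) r

theorem pairing_self_pos (hlam : -1 < lam) (ht : 0 < t) {p : ℝ[X]} (hp : p ≠ 0) :
    0 < pairing lam t p p := by
  rw [pairing, setIntegral_pos_iff_support_of_nonneg_ae _ (integrableOn_mul hlam ht p p)]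
  · have hsub : Ioi (0 : ℝ) \ (p.roots.toFinset : Set ℝ) ⊆
        (Function.support fun x : ℝ => p.eval x * p.eval x * weight lam t x) ∩ Ioi 0 := by
      intro x hx
      have h1 : p.eval x ≠ 0 := by
        intro h
        apply hx.2
        simp [hp, h]
      exact ⟨mul_ne_zero (mul_ne_zero h1 h1) (weight_pos hx.1).ne', hx.1⟩
    refine lt_of_lt_of_le ?_ (measure_mono hsub)
    rw [measure_sdiff_null ((Finset.finite_toSet _).measure_zero _)]
    simp
  · refine (ae_restrict_iff' measurableSet_Ioi).2 (Filter.Eventually.of_forall fun x hx => ?_)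
    exact mul_nonneg (mul_self_nonneg _) (weight_pos hx).le

theorem eq_zero_of_pairing_self (hlam : -1 < lam) (ht : 0 < t) {p : ℝ[X]}
    (h : pairing lam t p p = 0) : p = 0 := by
  by_contra hp
  exact (pairing_self_pos hlam ht hp).ne' h

theorem orthoPoly_monic_natDegree (n : ℕ) :
    (orthoPoly lam t n).Monic ∧ (orthoPoly lam t n).natDegree = n := by
  induction n using Nat.strong_induction_on with
  | _ n ih =>
    have hlt : (∑ k : Fin n, C (pairing lam t (X ^ n) (orthoPoly lam t k) /
        pairing lam t (orthoPoly lam t k) (orthoPoly lam t k)) * orthoPoly lam t k).degree < n := by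
      refine lt_of_le_of_lt (degree_sum_le _ _) ?_
      refine (Finset.sup_lt_iff (WithBot.bot_lt_coe n)).2 fun k _ => ?_
      refine lt_of_le_of_lt (degree_C_mul_le _ _) ?_
      rw [degree_eq_natDegree (ih k k.2).1.ne_zero, (ih k k.2).2]
      exact Nat.cast_lt.2 k.2
    rw [orthoPoly]
    refine ⟨monic_X_pow_sub hlt, ?_⟩
    · apply natDegree_eq_of_degree_eq_some
      rw [degree_sub_eq_left_of_degree_lt] <;> simp [hlt]

theorem orthoPoly_monic (n : ℕ) : (orthoPoly lam t n).Monic := (orthoPoly_monic_natDegree n).1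

theorem orthoPoly_natDegree (n : ℕ) : (orthoPoly lam t n).natDegree = n :=
  (orthoPoly_monic_natDegree n).2

theorem orthoPoly_degree (n : ℕ) : (orthoPoly lam t n).degree = n := by
  rw [degree_eq_natDegree (orthoPoly_monic n).ne_zero, orthoPoly_natDegree]

theorem normSq_pos (hlam : -1 < lam) (ht : 0 < t) (n : ℕ) : 0 < normSq lam n t :=
  pairing_self_pos hlam ht (orthoPoly_monic n).ne_zero

theorem pairing_orthoPoly_of_lt (hlam : -1 < lam) (ht : 0 < t) :
    ∀ n m : ℕ, m < n → pairing lam t (orthoPoly lam t n) (orthoPoly lam t m) = 0 := by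
  intro n
  induction n using Nat.strong_induction_on with
  | _ n ih =>
    intro m hm
    rw [orthoPoly.eq_1 lam t n, pairing_sub hlam ht, pairing_sum hlam ht,
      Finset.sum_eq_single (⟨m, hm⟩ : Fin n)]
    · have h := (normSq_pos hlam ht m).ne'
      rw [normSq] at h
      rw [pairing_C_mul, div_mul_cancel₀ _ h, sub_self]
    · intro k _ hk
      rw [pairing_C_mul]
      rcases lt_or_gt_of_ne (fun h => hk (Fin.ext h) : (k : ℕ) ≠ m) with h | h
      · rw [pairing_comm (orthoPoly lam t k) (orthoPoly lam t m), ih m hm k h, mul_zero]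
      · rw [ih k k.2 m h, mul_zero]
    · simp

/-- Orthogonality: `∫ P_m P_n w = 0` for `m ≠ n`. -/
theorem pairing_orthoPoly_of_ne (hlam : -1 < lam) (ht : 0 < t) {m n : ℕ} (h : m ≠ n) :
    pairing lam t (orthoPoly lam t m) (orthoPoly lam t n) = 0 := by
  rcases lt_or_gt_of_ne h with h | h
  · rw [pairing_comm, pairing_orthoPoly_of_lt hlam ht _ _ h]
  · exact pairing_orthoPoly_of_lt hlam ht _ _ h

theorem pairing_eq_zero_of_degree_lt (hlam : -1 < lam) (ht : 0 < t) (p : ℝ[X]) :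
    ∀ (m : ℕ) (q : ℝ[X]), (∀ k < m, pairing lam t p (orthoPoly lam t k) = 0) → q.degree < m →
      pairing lam t p q = 0 := by
  intro m
  induction m with
  | zero =>
    intro q _ hq
    have : q = 0 := by simpa [degree_eq_bot, Nat.WithBot.lt_zero_iff] using hq
    simp [this, pairing]
  | succ m ih =>
    intro q hp hq
    have hd : (q - C (q.coeff m) * orthoPoly lam t m).degree < m := by
      rw [degree_lt_iff_coeff_zero]
      intro j hj
      have hj' : j = m ∨ m + 1 ≤ j := by omega
      rcases hj' with rfl | hj'
      · have := (orthoPoly_monic (lam := lam) (t := t) j).coeff_natDegree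
        rw [orthoPoly_natDegree] at this
        simp [this]
      · have h1 : q.coeff j = 0 := (degree_lt_iff_coeff_zero q (m + 1)).1 hq j hj'
        have h2 : (orthoPoly lam t m).coeff j = 0 :=
          coeff_eq_zero_of_natDegree_lt (by rw [orthoPoly_natDegree]; omega)
        simp [h1, h2]
    have h := ih _ (fun k hk => hp k (by omega)) hd
    rwa [pairing_comm, pairing_sub hlam ht, pairing_C_mul, pairing_comm (orthoPoly lam t m),
      hp m (by omega), mul_zero, sub_zero, pairing_comm] at h

/-- Uniqueness: a monic polynomial of degree `n` orthogonal to all polynomials of lower degree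
is `P_n`. -/
theorem eq_orthoPoly (hlam : -1 < lam) (ht : 0 < t) {n : ℕ} {p : ℝ[X]} (hp : p.Monic)
    (hd : p.natDegree = n) (ho : ∀ q : ℝ[X], q.degree < n → pairing lam t p q = 0) :
    p = orthoPoly lam t n := by
  have hlt : (p - orthoPoly lam t n).degree < n := by
    have hpd : p.degree = n := by rw [degree_eq_natDegree hp.ne_zero, hd]
    rw [← hpd]
    exact degree_sub_lt_left (by rw [hpd, orthoPoly_degree]) hp.ne_zero
      (by rw [hp.leadingCoeff, (orthoPoly_monic n).leadingCoeff])
  refine sub_eq_zero.1 (eq_zero_of_pairing_self hlam ht ?_)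
  rw [pairing_sub hlam ht, ho _ hlt, pairing_eq_zero_of_degree_lt hlam ht _ n _
    (fun k hk => pairing_orthoPoly_of_lt hlam ht n k hk) hlt, sub_zero]

theorem eq_zero_of_orthogonal (hlam : -1 < lam) (ht : 0 < t) {p : ℝ[X]} {m : ℕ}
    (hd : p.degree < m) (h : ∀ k < m, pairing lam t p (orthoPoly lam t k) = 0) : p = 0 :=
  eq_zero_of_pairing_self hlam ht (pairing_eq_zero_of_degree_lt hlam ht p m p h hd)

theorem X_mul_sub_degree_lt (n : ℕ) :
    (X * orthoPoly lam t n - orthoPoly lam t (n + 1)).degree < ((n + 1 : ℕ) : WithBot ℕ) := by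
  have h1 : (X * orthoPoly lam t n).Monic := monic_X.mul (orthoPoly_monic n)
  have h2 : (X * orthoPoly lam t n).degree = ((n + 1 : ℕ) : WithBot ℕ) := by
    rw [degree_mul, degree_X, orthoPoly_degree]; push_cast; ring
  rw [← h2]
  exact degree_sub_lt_left (by rw [h2, orthoPoly_degree]) h1.ne_zero
    (by rw [h1.leadingCoeff, (orthoPoly_monic _).leadingCoeff])

/-- The three-term recurrence relation at `n = 0`: `x P_0 = P_1 + α_0 P_0`. -/
theorem recurrence_zero (hlam : -1 < lam) (ht : 0 < t) :
    X * orthoPoly lam t 0 = orthoPoly lam t 1 + C (alpha lam 0 t) * orthoPoly lam t 0 := by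
  rw [← sub_eq_zero, ← sub_sub]
  refine eq_zero_of_orthogonal hlam ht (m := 1) ?_ ?_
  · refine lt_of_le_of_lt (degree_sub_le _ _) (max_lt (X_mul_sub_degree_lt 0) ?_)
    refine lt_of_le_of_lt (degree_C_mul_le _ _) ?_
    rw [orthoPoly_degree]; exact_mod_cast Nat.zero_lt_one
  · intro k hk
    obtain rfl : k = 0 := by omega
    have h : alpha lam 0 t * pairing lam t (orthoPoly lam t 0) (orthoPoly lam t 0) =
        pairing lam t (X * orthoPoly lam t 0) (orthoPoly lam t 0) :=
      div_mul_cancel₀ _ (normSq_pos hlam ht 0).ne'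
    rw [pairing_sub hlam ht, pairing_sub hlam ht, pairing_C_mul, h,
      pairing_orthoPoly_of_ne hlam ht one_ne_zero]
    ring

/-- The three-term recurrence relation `x P_n = P_{n+1} + α_n P_n + β_n P_{n-1}`, written
with `n + 1` in place of `n`. -/
theorem recurrence_succ (hlam : -1 < lam) (ht : 0 < t) (n : ℕ) :
    X * orthoPoly lam t (n + 1) = orthoPoly lam t (n + 2) +
      C (alpha lam (n + 1 : ℕ) t) * orthoPoly lam t (n + 1) +
      C (beta lam (n + 1 : ℕ) t) * orthoPoly lam t n := by
  rw [← sub_eq_zero, ← sub_sub, ← sub_sub]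
  refine eq_zero_of_orthogonal hlam ht (m := n + 2) ?_ ?_
  · refine lt_of_le_of_lt (degree_sub_le _ _) (max_lt (lt_of_le_of_lt (degree_sub_le _ _)
      (max_lt (X_mul_sub_degree_lt (n + 1)) ?_)) ?_)
    · refine lt_of_le_of_lt (degree_C_mul_le _ _) ?_
      rw [orthoPoly_degree]; exact_mod_cast Nat.lt_succ_self (n + 1)
    · refine lt_of_le_of_lt (degree_C_mul_le _ _) ?_
      rw [orthoPoly_degree]; exact_mod_cast (by omega : n < n + 2)
  · intro k hk
    rw [pairing_sub hlam ht, pairing_sub hlam ht, pairing_sub hlam ht, pairing_C_mul, pairing_C_mul,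
      pairing_orthoPoly_of_ne hlam ht (show n + 2 ≠ k by omega)]
    have hk' : k = n + 1 ∨ k = n ∨ k < n := by omega
    rcases hk' with rfl | rfl | hk'
    · have h : alpha lam (n + 1 : ℕ) t *
          pairing lam t (orthoPoly lam t (n + 1)) (orthoPoly lam t (n + 1)) =
          pairing lam t (X * orthoPoly lam t (n + 1)) (orthoPoly lam t (n + 1)) :=
        div_mul_cancel₀ _ (normSq_pos hlam ht (n + 1)).ne'
      rw [h, pairing_orthoPoly_of_ne hlam ht (show n ≠ n + 1 by omega)]
      ring
    · have h : beta lam (k + 1 : ℕ) t *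
          pairing lam t (orthoPoly lam t k) (orthoPoly lam t k) =
          pairing lam t (X * orthoPoly lam t (k + 1)) (orthoPoly lam t k) :=
        div_mul_cancel₀ _ (normSq_pos hlam ht k).ne'
      rw [h, pairing_orthoPoly_of_ne hlam ht (show k + 1 ≠ k by omega)]
      ring
    · rw [pairing_orthoPoly_of_ne hlam ht (show n + 1 ≠ k by omega),
        pairing_orthoPoly_of_ne hlam ht (show n ≠ k by omega), pairing_X_mul,
        pairing_eq_zero_of_degree_lt hlam ht _ (n + 1) _
          (fun j hj => pairing_orthoPoly_of_lt hlam ht (n + 1) j hj) ?_]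
      · ring
      · rw [degree_mul, degree_X, orthoPoly_degree]
        exact_mod_cast (by omega : 1 + k < n + 1)

end Basic

end

end SingularAiry

/-!
Write `⟨p, q⟩` for the pairing, `h_n` for the squared norms and `θ = t d/dt`. Differentiating the
weight in `t` gives `θ w = -(t/x) w`, and the factor `1/x`, which is not polynomial, is traded for
polynomial factors by integrating `(x^(k+1) w)'` over `(0, ∞)`. On moments this reads
`θ μ_k = (k + 1 + λ) μ_k - 3 μ_{k+3}` (`hasDerivAt_moment`), and for polynomials `p`, `q` depending
on `t` it becomes (`hasDerivAt_pairing`)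
`θ⟨p, q⟩ = ⟨θp, q⟩ + ⟨p, θq⟩ + (1 + λ)⟨p, q⟩ + ⟨x p', q⟩ + ⟨p, x q'⟩ - 3⟨x³ p, q⟩`.
In effect `t` is a scaling parameter combined with the time of the third Toda flow, which is why no
discrete (string) equation is needed.

By Gram-Schmidt, `P_n` is differentiable in `t`, and `θ P_n` has degree less than `n` since `P_n` is
monic. Hence almost all terms vanish when the identity is applied to `⟨P_n, P_n⟩ = h_n` and to
`⟨P_{n+1}, P_n⟩ = 0`. What remains (`hasDerivAt_normSq`, `hasDerivAt_nextCoeff_succ`) is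
`θ h_n = (1 + λ + 2n) h_n - 3⟨x³ P_n, P_n⟩` and, for the subleading coefficient `p_{n+1}` of
`P_{n+1}`, `θ p_{n+1} = p_{n+1} + 3⟨x³ P_{n+1}, P_n⟩ / h_n`. Since `α_n = p_n - p_{n+1}` and
`β_{n+1} = h_{n+1} / h_n`, the equations follow once the entries `⟨x³ P_n, P_n⟩` and
`⟨x³ P_{n+1}, P_n⟩` are expanded by the recurrence relation (`pairing_X_pow_three_self`,
`pairing_X_pow_three_succ`).
-/

namespace SingularAiry

open MeasureTheory Set Polynomial

noncomputable section

variable {lam t : ℝ}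

/-! ### Moments: dependence on `t` and integration by parts -/

/-- The moments `μ_k(t) = ∫_0^∞ x^k w(x;t) dx`. -/
def moment (lam : ℝ) (k : ℕ) (t : ℝ) : ℝ := ∫ x in Ioi (0 : ℝ), x ^ k * weight lam t x

/-- Part of the exponential factor absorbs the singularity of `1/x`; this is what makes the
`t`-derivative of the weight integrable, uniformly for `t` bounded below. -/
theorem inv_mul_weight_le {s c x : ℝ} (hc : 0 < c) (hs : 2 * c ≤ s) (hx : 0 < x) :
    x⁻¹ * weight lam s x ≤ c⁻¹ * weight lam c x := by
  have h1 : c / x ≤ Real.exp (c / x) := by linarith [Real.add_one_le_exp (c / x)]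
  have h2 : x⁻¹ ≤ c⁻¹ * Real.exp (c / x) := by
    calc x⁻¹ = c⁻¹ * (c / x) := by field_simp
      _ ≤ _ := by gcongr
  have h3 : Real.exp (c / x) * Real.exp (-x ^ 3 - s / x) ≤ Real.exp (-x ^ 3 - c / x) := by
    rw [← Real.exp_add]
    apply Real.exp_le_exp.2
    have : 2 * c / x ≤ s / x := by gcongr
    have e : 2 * c / x = c / x + c / x := by ring
    linarith
  have hp : 0 < x ^ lam := Real.rpow_pos_of_pos hx _
  unfold weight
  calc x⁻¹ * (x ^ lam * Real.exp (-x ^ 3 - s / x))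
      ≤ (c⁻¹ * Real.exp (c / x)) * (x ^ lam * Real.exp (-x ^ 3 - s / x)) := by gcongr
    _ = c⁻¹ * (x ^ lam * (Real.exp (c / x) * Real.exp (-x ^ 3 - s / x))) := by ring
    _ ≤ _ := by gcongr

theorem measurable_weight : Measurable (weight lam t) := by
  unfold weight
  fun_prop

theorem hasDerivAt_weight_param {x : ℝ} :
    HasDerivAt (fun s => weight lam s x) (-(x⁻¹ * weight lam t x)) t := by
  unfold weight
  have h := ((((hasDerivAt_id t).div_const x).const_sub (-x ^ 3)).exp).const_mul (x ^ lam)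
  refine h.congr_deriv ?_
  simp only [id]
  ring

theorem hasDerivAt_moment_inv (hlam : -1 < lam) (ht : 0 < t) (k : ℕ) :
    IntegrableOn (fun x : ℝ => x ^ k * (x⁻¹ * weight lam t x)) (Ioi 0) ∧
    HasDerivAt (moment lam k) (-∫ x in Ioi (0 : ℝ), x ^ k * (x⁻¹ * weight lam t x)) t := by
  have hc : 0 < t / 4 := by positivity
  have h := hasDerivAt_integral_of_dominated_loc_of_deriv_le (μ := volume.restrict (Ioi (0 : ℝ)))
    (F := fun s x => x ^ k * weight lam s x)
    (F' := fun s x => -(x ^ k * (x⁻¹ * weight lam s x)))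
    (bound := fun x => (t / 4)⁻¹ * (x ^ k * weight lam (t / 4) x))
    -- On this neighbourhood of `t` the weight with parameter `t / 4` dominates.
    (x₀ := t) (s := Ioi (2 * (t / 4))) (Ioi_mem_nhds (by linarith))
    (Filter.Eventually.of_forall fun s =>
      ((measurable_id.pow_const k).mul measurable_weight).aestronglyMeasurable)
    (integrableOn_pow_mul_weight hlam ht k)
    (((measurable_id.pow_const k).mul
      (measurable_inv.mul measurable_weight)).neg.aestronglyMeasurable)
    ((ae_restrict_iff' measurableSet_Ioi).2 (Filter.Eventually.of_forall fun x hx s hs => by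
      have hx : 0 < x := hx
      rw [norm_neg, Real.norm_of_nonneg (by have := weight_pos (lam := lam) (t := s) hx; positivity)]
      calc x ^ k * (x⁻¹ * weight lam s x) ≤ x ^ k * ((t / 4)⁻¹ * weight lam (t / 4) x) := by
            gcongr x ^ k * ?_
            exact inv_mul_weight_le hc (le_of_lt hs) hx
        _ = _ := by ring))
    ((integrableOn_pow_mul_weight hlam hc k).const_mul _)
    (Filter.Eventually.of_forall fun x s _ => by
      refine (hasDerivAt_weight_param.const_mul (x ^ k)).congr_deriv ?_
      ring)
  refine ⟨by simpa [IntegrableOn] using h.1.neg, ?_⟩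
  rw [← integral_neg]
  exact h.2

theorem hasDerivAt_pow_mul_weight {x : ℝ} (hx : 0 < x) (k : ℕ) :
    HasDerivAt (fun y => y ^ (k + 1) * weight lam t y)
      ((k + 1 + lam) * (x ^ k * weight lam t x) - 3 * (x ^ (k + 3) * weight lam t x) +
        t * (x ^ k * (x⁻¹ * weight lam t x))) x := by
  have h1 := Real.hasDerivAt_rpow_const (x := x) (p := lam) (Or.inl hx.ne')
  have h2 : HasDerivAt (fun y => Real.exp (-y ^ 3 - t / y))
      (Real.exp (-x ^ 3 - t / x) * (-(3 * x ^ 2) + t / x ^ 2)) x := by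
    simp only [div_eq_mul_inv t]
    refine (((hasDerivAt_pow 3 x).neg).sub ((hasDerivAt_inv hx.ne').const_mul t)).exp.congr_deriv ?_
    simp
  refine ((hasDerivAt_pow (k + 1) x).mul (h1.mul h2)).congr_deriv ?_
  simp only [Pi.mul_apply, Nat.add_sub_cancel, Nat.cast_add, Nat.cast_one, weight]
  rw [Real.rpow_sub_one hx.ne']
  field_simp
  ring

theorem continuousWithinAt_pow_mul_weight (hlam : -1 < lam) (ht : 0 < t) (k : ℕ) :
    ContinuousWithinAt (fun y => y ^ (k + 1) * weight lam t y) (Ici 0) 0 := by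
  have hc : 0 < lam + (k + 1 : ℕ) := by push_cast; have : (0 : ℝ) ≤ k := k.cast_nonneg; linarith
  have h0 : Filter.Tendsto (fun y : ℝ => y ^ (lam + (k + 1 : ℕ))) (nhdsWithin 0 (Ici 0)) (nhds 0) := by
    have := (Real.continuousAt_rpow_const 0 _ (Or.inr hc.le)).tendsto
    rw [Real.zero_rpow hc.ne'] at this
    exact this.mono_left nhdsWithin_le_nhds
  unfold ContinuousWithinAt
  beta_reduce
  rw [zero_pow (Nat.succ_ne_zero k), zero_mul]
  refine squeeze_zero' ?_ ?_ h0
  · filter_upwards [self_mem_nhdsWithin] with y hy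
    have hy : 0 ≤ y := hy
    unfold weight
    positivity
  · filter_upwards [self_mem_nhdsWithin] with y hy
    rcases (show 0 ≤ y from hy).eq_or_lt with rfl | hy
    · rw [zero_pow (Nat.succ_ne_zero k), zero_mul, Real.zero_rpow hc.ne']
    · rw [Real.rpow_add hy, Real.rpow_natCast, weight, mul_comm (y ^ lam) (y ^ (k + 1)), ← mul_assoc]
      refine mul_le_of_le_one_right (by positivity) (Real.exp_le_one_iff.2 ?_)
      have : 0 < t / y := by positivity
      have : 0 < y ^ 3 := by positivity
      linarith

/-- Differentiating `w` in `t` produces the factor `-1/x`, which is removed again by integrating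
`(x^(k+1) w)'` over `(0, ∞)`. -/
theorem hasDerivAt_moment (hlam : -1 < lam) (ht : 0 < t) (k : ℕ) :
    HasDerivAt (moment lam k)
      (((k + 1 + lam) * moment lam k t - 3 * moment lam (k + 3) t) / t) t := by
  obtain ⟨hi, hd⟩ := hasDerivAt_moment_inv hlam ht k
  have i1 := (integrableOn_pow_mul_weight hlam ht k).const_mul (k + 1 + lam)
  have i2 := (integrableOn_pow_mul_weight hlam ht (k + 3)).const_mul 3
  have i3 := hi.const_mul t
  have i12 : IntegrableOn (fun x : ℝ => (k + 1 + lam) * (x ^ k * weight lam t x) -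
      3 * (x ^ (k + 3) * weight lam t x)) (Ioi 0) := i1.sub i2
  have hderiv : ∀ x ∈ Ioi (0 : ℝ), HasDerivAt (fun y => y ^ (k + 1) * weight lam t y) _ x :=
    fun x hx => hasDerivAt_pow_mul_weight hx k
  have h := integral_Ioi_of_hasDerivAt_of_tendsto
    (continuousWithinAt_pow_mul_weight hlam ht k) hderiv (i12.add i3)
    (tendsto_zero_of_hasDerivAt_of_integrableOn_Ioi hderiv (i12.add i3)
      (integrableOn_pow_mul_weight hlam ht (k + 1)))
  rw [zero_pow (Nat.succ_ne_zero k), zero_mul, sub_zero, integral_add i12 i3,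
    integral_sub i1 i2, integral_const_mul, integral_const_mul, integral_const_mul] at h
  refine hd.congr_deriv ?_
  rw [eq_div_iff ht.ne']
  unfold moment
  linarith

/-! ### Curves of polynomials -/

/-- `P'` is the coefficientwise derivative at `t` of the curve `s ↦ P s` of polynomials. The degrees
are required to be bounded uniformly in `s`, so that the curve stays in a finite-dimensional
space. -/
def HasCoeffDerivAt (P : ℝ → ℝ[X]) (P' : ℝ[X]) (t : ℝ) : Prop :=
  (∃ N, ∀ s, (P s).natDegree ≤ N) ∧ ∀ k, HasDerivAt (fun s => (P s).coeff k) (P'.coeff k) t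

theorem hasCoeffDerivAt_const (p : ℝ[X]) : HasCoeffDerivAt (fun _ => p) 0 t :=
  ⟨⟨p.natDegree, fun _ => le_rfl⟩, fun k => by simpa using hasDerivAt_const t (p.coeff k)⟩

theorem hasCoeffDerivAt_C {f : ℝ → ℝ} {f' : ℝ} (h : HasDerivAt f f' t) :
    HasCoeffDerivAt (fun s => C (f s)) (C f') t := by
  refine ⟨⟨0, fun s => by simp⟩, fun k => ?_⟩
  rcases k with _ | k
  · simpa using h
  · simpa [coeff_C] using hasDerivAt_const t (0 : ℝ)

theorem HasCoeffDerivAt.sub {P Q : ℝ → ℝ[X]} {P' Q' : ℝ[X]} (hP : HasCoeffDerivAt P P' t)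
    (hQ : HasCoeffDerivAt Q Q' t) : HasCoeffDerivAt (fun s => P s - Q s) (P' - Q') t := by
  obtain ⟨⟨M, hM⟩, hP⟩ := hP
  obtain ⟨⟨N, hN⟩, hQ⟩ := hQ
  refine ⟨⟨max M N, fun s => (natDegree_sub_le _ _).trans (max_le_max (hM s) (hN s))⟩, fun k => ?_⟩
  simpa only [coeff_sub] using (hP k).fun_sub (hQ k)

theorem HasCoeffDerivAt.mul {P Q : ℝ → ℝ[X]} {P' Q' : ℝ[X]} (hP : HasCoeffDerivAt P P' t)
    (hQ : HasCoeffDerivAt Q Q' t) :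
    HasCoeffDerivAt (fun s => P s * Q s) (P' * Q t + P t * Q') t := by
  obtain ⟨⟨M, hM⟩, hP⟩ := hP
  obtain ⟨⟨N, hN⟩, hQ⟩ := hQ
  refine ⟨⟨M + N, fun s => natDegree_mul_le_of_le (hM s) (hN s)⟩, fun k => ?_⟩
  simp only [coeff_add, coeff_mul, ← Finset.sum_add_distrib]
  exact HasDerivAt.fun_sum fun i _ => (hP i.1).fun_mul (hQ i.2)

theorem HasCoeffDerivAt.sum {ι : Type} (u : Finset ι) {P : ι → ℝ → ℝ[X]} {P' : ι → ℝ[X]}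
    (h : ∀ i ∈ u, HasCoeffDerivAt (P i) (P' i) t) :
    HasCoeffDerivAt (fun s => ∑ i ∈ u, P i s) (∑ i ∈ u, P' i) t := by
  refine ⟨?_, fun k => ?_⟩
  · choose! N hN using fun i hi => (h i hi).1
    refine ⟨u.sup N, fun s => natDegree_sum_le_of_forall_le _ _ fun i hi => ?_⟩
    exact (hN i hi s).trans (Finset.le_sup hi)
  · simp only [finsetSum_coeff]
    exact HasDerivAt.fun_sum fun i hi => (h i hi).2 k

theorem HasCoeffDerivAt.coeff_eq_zero {P : ℝ → ℝ[X]} {P' : ℝ[X]} (h : HasCoeffDerivAt P P' t)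
    {k : ℕ} {c : ℝ} (hk : ∀ s, (P s).coeff k = c) : P'.coeff k = 0 := by
  refine (h.2 k).unique ?_
  simp only [hk]
  exact hasDerivAt_const t c

/-- The moment functional `p ↦ ∫_0^∞ p(x) w(x;t) dx`. -/
def momentFunctional (lam t : ℝ) (p : ℝ[X]) : ℝ := ∫ x in Ioi (0 : ℝ), p.eval x * weight lam t x

theorem pairing_eq_momentFunctional (p q : ℝ[X]) :
    pairing lam t p q = momentFunctional lam t (p * q) := by
  simp [pairing, momentFunctional]

theorem momentFunctional_add (hlam : -1 < lam) (ht : 0 < t) (p q : ℝ[X]) :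
    momentFunctional lam t (p + q) = momentFunctional lam t p + momentFunctional lam t q := by
  simp only [momentFunctional, eval_add, add_mul]
  exact integral_add (integrableOn_eval_mul_weight hlam ht p) (integrableOn_eval_mul_weight hlam ht q)

theorem momentFunctional_X_pow_mul (hlam : -1 < lam) (ht : 0 < t) (j : ℕ) {N : ℕ} {p : ℝ[X]}
    (hp : p.natDegree ≤ N) : momentFunctional lam t (X ^ j * p) =
      ∑ k ∈ Finset.range (N + 1), p.coeff k * moment lam (k + j) t := by
  simp only [momentFunctional, moment, ← integral_const_mul]
  rw [← integral_finsetSum]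
  · congr 1
    ext x
    rw [eval_mul, eval_pow, eval_X, eval_eq_sum_range' (Nat.lt_succ_of_le hp), Finset.mul_sum,
      Finset.sum_mul]
    refine Finset.sum_congr rfl fun k _ => ?_
    ring
  · exact fun k _ => (integrableOn_pow_mul_weight hlam ht (k + j)).const_mul _

theorem momentFunctional_eq_sum (hlam : -1 < lam) (ht : 0 < t) {N : ℕ} {p : ℝ[X]}
    (hp : p.natDegree ≤ N) : momentFunctional lam t p =
      ∑ k ∈ Finset.range (N + 1), p.coeff k * moment lam k t := by
  simpa using momentFunctional_X_pow_mul hlam ht 0 hp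

theorem coeff_X_mul_derivative (p : ℝ[X]) (k : ℕ) :
    (X * derivative p).coeff k = k * p.coeff k := by
  rcases k with _ | k
  · simp
  · rw [coeff_X_mul, coeff_derivative]
    push_cast
    ring

theorem hasDerivAt_momentFunctional (hlam : -1 < lam) (ht : 0 < t) {P : ℝ → ℝ[X]} {P' : ℝ[X]}
    (h : HasCoeffDerivAt P P' t) :
    HasDerivAt (fun s => momentFunctional lam s (P s))
      (momentFunctional lam t P' + ((1 + lam) * momentFunctional lam t (P t) +
        momentFunctional lam t (X * derivative (P t)) -
        3 * momentFunctional lam t (X ^ 3 * P t)) / t) t := by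
  obtain ⟨N, hN⟩ := h.1
  have hP' : P'.natDegree ≤ N := natDegree_le_iff_coeff_eq_zero.2 fun k hk =>
    h.coeff_eq_zero (c := 0) fun s => coeff_eq_zero_of_natDegree_lt ((hN s).trans_lt hk)
  have hXP : (X * derivative (P t)).natDegree ≤ N := natDegree_le_iff_coeff_eq_zero.2 fun k hk => by
    rw [coeff_X_mul_derivative, coeff_eq_zero_of_natDegree_lt ((hN t).trans_lt hk), mul_zero]
  rw [momentFunctional_eq_sum hlam ht hP', momentFunctional_eq_sum hlam ht (hN t),
    momentFunctional_eq_sum hlam ht hXP, momentFunctional_X_pow_mul hlam ht 3 (hN t)]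
  have hsum : HasDerivAt
      (fun s => ∑ k ∈ Finset.range (N + 1), (P s).coeff k * moment lam k s) _ t :=
    HasDerivAt.fun_sum fun k _ => (h.2 k).fun_mul (hasDerivAt_moment hlam ht k)
  refine (hsum.congr_of_eventuallyEq ?_).congr_deriv ?_
  · filter_upwards [lt_mem_nhds ht] with s hs
    exact momentFunctional_eq_sum hlam hs (hN s)
  · simp only [coeff_X_mul_derivative, Finset.mul_sum, ← Finset.sum_add_distrib, ← Finset.sum_sub_distrib,
      Finset.sum_div]
    refine Finset.sum_congr rfl fun k _ => ?_
    ring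

/-- Beyond the product rule, the dependence of the weight on `t` contributes only a multiple of the
pairing itself, the Euler operator
`x d/dx`, which does not raise degrees, and multiplication by `x^3`. -/
theorem hasDerivAt_pairing (hlam : -1 < lam) (ht : 0 < t) {P Q : ℝ → ℝ[X]} {P' Q' : ℝ[X]}
    (hP : HasCoeffDerivAt P P' t) (hQ : HasCoeffDerivAt Q Q' t) :
    HasDerivAt (fun s => pairing lam s (P s) (Q s))
      (pairing lam t P' (Q t) + pairing lam t (P t) Q' + ((1 + lam) * pairing lam t (P t) (Q t) +
        (pairing lam t (X * derivative (P t)) (Q t) + pairing lam t (P t) (X * derivative (Q t))) -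
        3 * pairing lam t (X ^ 3 * P t) (Q t)) / t) t := by
  simp only [pairing_eq_momentFunctional]
  refine (hasDerivAt_momentFunctional hlam ht (hP.mul hQ)).congr_deriv ?_
  rw [← momentFunctional_add hlam ht, ← momentFunctional_add hlam ht, derivative_mul, mul_add,
    ← mul_assoc X, mul_left_comm X, ← mul_assoc (X ^ 3)]

/-- The orthogonal polynomials depend differentiably on `t`: the Gram-Schmidt process only involves
pairings and divisions by the non-vanishing norms. -/
theorem exists_hasCoeffDerivAt_orthoPoly (hlam : -1 < lam) (ht : 0 < t) (n : ℕ) :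
    ∃ P' : ℝ[X], HasCoeffDerivAt (fun s => orthoPoly lam s n) P' t := by
  induction n using Nat.strong_induction_on with
  | _ n ih =>
    choose P' hP' using fun k : Fin n => ih k k.2
    have hterm : ∀ k : Fin n, ∃ T' : ℝ[X], HasCoeffDerivAt
        (fun s => C (pairing lam s (X ^ n) (orthoPoly lam s k) /
          pairing lam s (orthoPoly lam s k) (orthoPoly lam s k)) * orthoPoly lam s k) T' t :=
      fun k => ⟨_, (hasCoeffDerivAt_C ((hasDerivAt_pairing hlam ht
        (hasCoeffDerivAt_const (X ^ n)) (hP' k)).fun_div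
        (hasDerivAt_pairing hlam ht (hP' k) (hP' k)) (normSq_pos hlam ht k).ne')).mul (hP' k)⟩
    choose T' hT' using hterm
    rw [funext fun s => orthoPoly.eq_1 lam s n]
    exact ⟨_, (hasCoeffDerivAt_const (X ^ n)).sub
      (HasCoeffDerivAt.sum Finset.univ fun k _ => hT' k)⟩

/-! ### Norms and subleading coefficients -/

theorem orthoPoly_coeff_self (n : ℕ) : (orthoPoly lam t n).coeff n = 1 := by
  simpa [orthoPoly_natDegree] using (orthoPoly_monic (lam := lam) (t := t) n).coeff_natDegree

theorem orthoPoly_coeff_of_lt {n k : ℕ} (h : n < k) : (orthoPoly lam t n).coeff k = 0 :=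
  coeff_eq_zero_of_natDegree_lt (by rwa [orthoPoly_natDegree])

theorem pairing_orthoPoly_right_eq_zero (hlam : -1 < lam) (ht : 0 < t) {n : ℕ} {q : ℝ[X]}
    (hq : q.degree < n) : pairing lam t q (orthoPoly lam t n) = 0 := by
  rw [pairing_comm]
  exact pairing_eq_zero_of_degree_lt hlam ht _ n q
    (fun k hk => pairing_orthoPoly_of_lt hlam ht n k hk) hq

/-- Pairing a polynomial of degree at most `n` with `P_n` reads off its coefficient of `x^n`. -/
theorem pairing_orthoPoly_eq_coeff_mul (hlam : -1 < lam) (ht : 0 < t) {n : ℕ} {q : ℝ[X]}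
    (hq : q.degree < (n + 1 : ℕ)) :
    pairing lam t q (orthoPoly lam t n) = q.coeff n * normSq lam n t := by
  have h := pairing_orthoPoly_right_eq_zero (n := n) hlam ht
    (q := q - C (q.coeff n) * orthoPoly lam t n) <| by
      rw [degree_lt_iff_coeff_zero]
      intro j hj
      rcases hj.eq_or_lt with rfl | hj
      · simp [orthoPoly_coeff_self]
      · simp [orthoPoly_coeff_of_lt hj, (degree_lt_iff_coeff_zero q (n + 1)).1 hq j hj]
  rw [pairing_sub hlam ht, pairing_C_mul] at h
  exact sub_eq_zero.1 h

theorem nextCoeff_orthoPoly_succ (n : ℕ) :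
    (orthoPoly lam t (n + 1)).nextCoeff = (orthoPoly lam t (n + 1)).coeff n := by
  rw [nextCoeff_of_natDegree_pos (by rw [orthoPoly_natDegree]; omega), orthoPoly_natDegree]
  rfl

theorem nextCoeff_orthoPoly_zero : (orthoPoly lam t 0).nextCoeff = 0 := by
  simp [nextCoeff, orthoPoly_natDegree]

theorem degree_X_mul_derivative_lt {p : ℝ[X]} {n : ℕ} (hp : p.degree < (n : WithBot ℕ)) :
    (X * derivative p).degree < (n : WithBot ℕ) := by
  rw [degree_lt_iff_coeff_zero] at hp ⊢
  intro j hj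
  rw [coeff_X_mul_derivative, hp j hj, mul_zero]

theorem orthoPoly_degree_lt_succ (n : ℕ) : (orthoPoly lam t n).degree < (n + 1 : ℕ) := by
  rw [orthoPoly_degree]
  exact_mod_cast n.lt_succ_self

/-- The leading coefficient is constant, so the `t`-derivative of `P_n` has smaller degree. -/
theorem HasCoeffDerivAt.degree_lt {n : ℕ} {P' : ℝ[X]}
    (h : HasCoeffDerivAt (fun s => orthoPoly lam s n) P' t) : P'.degree < n := by
  rw [degree_lt_iff_coeff_zero]
  intro j hj
  rcases hj.eq_or_lt with rfl | hj
  · exact h.coeff_eq_zero fun s => orthoPoly_coeff_self n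
  · exact h.coeff_eq_zero fun s => orthoPoly_coeff_of_lt hj

theorem hasDerivAt_normSq (hlam : -1 < lam) (ht : 0 < t) (n : ℕ) :
    HasDerivAt (normSq lam n) (((1 + lam + 2 * n) * normSq lam n t -
      3 * pairing lam t (X ^ 3 * orthoPoly lam t n) (orthoPoly lam t n)) / t) t := by
  obtain ⟨P', hP'⟩ := exists_hasCoeffDerivAt_orthoPoly hlam ht n
  refine (hasDerivAt_pairing hlam ht hP' hP').congr_deriv ?_
  rw [pairing_comm (orthoPoly lam t n) P', pairing_orthoPoly_right_eq_zero hlam ht hP'.degree_lt,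
    pairing_comm (orthoPoly lam t n) (X * _), pairing_orthoPoly_eq_coeff_mul hlam ht
      (degree_X_mul_derivative_lt (orthoPoly_degree_lt_succ n)),
    coeff_X_mul_derivative, orthoPoly_coeff_self, ← normSq]
  ring

/-- The evolution of the subleading coefficient of `P_{n+1}`, obtained by differentiating
`⟨P_{n+1}, P_n⟩ = 0`. -/
theorem hasDerivAt_nextCoeff_succ (hlam : -1 < lam) (ht : 0 < t) (n : ℕ) :
    HasDerivAt (fun s => (orthoPoly lam s (n + 1)).nextCoeff)
      (((orthoPoly lam t (n + 1)).nextCoeff +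
        3 * (pairing lam t (X ^ 3 * orthoPoly lam t (n + 1)) (orthoPoly lam t n) /
          normSq lam n t)) / t) t := by
  obtain ⟨P', hP'⟩ := exists_hasCoeffDerivAt_orthoPoly hlam ht n
  obtain ⟨Q', hQ'⟩ := exists_hasCoeffDerivAt_orthoPoly hlam ht (n + 1)
  simp only [nextCoeff_orthoPoly_succ]
  refine (hQ'.2 n).congr_deriv ?_
  have hzero : (fun s => pairing lam s (orthoPoly lam s (n + 1)) (orthoPoly lam s n)) =ᶠ[nhds t]
      fun _ => 0 := by
    filter_upwards [lt_mem_nhds ht] with s hs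
    exact pairing_orthoPoly_of_lt hlam hs _ _ n.lt_succ_self
  have h := ((hasDerivAt_pairing hlam ht hQ' hP').congr_of_eventuallyEq hzero.symm).unique
    (hasDerivAt_const t (0 : ℝ))
  -- `x P_{n+1}'` has degree `n + 1`; its leading term is removed by subtracting `(n + 1) P_{n+1}`.
  have hd : (X * derivative (orthoPoly lam t (n + 1)) -
      C ((n + 1 : ℕ) : ℝ) * orthoPoly lam t (n + 1)).degree < ((n + 1 : ℕ) : WithBot ℕ) := by
    rw [degree_lt_iff_coeff_zero]
    intro j hj
    rw [coeff_sub, coeff_X_mul_derivative, coeff_C_mul]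
    rcases hj.eq_or_lt with rfl | hj
    · exact sub_self _
    · rw [orthoPoly_coeff_of_lt hj]
      ring
  have h0 := pairing_orthoPoly_of_lt (lam := lam) hlam ht _ _ n.lt_succ_self
  have hE := pairing_orthoPoly_eq_coeff_mul hlam ht hd
  rw [pairing_sub hlam ht, pairing_C_mul, h0, coeff_sub, coeff_X_mul_derivative, coeff_C_mul,
    mul_zero, sub_zero] at hE
  rw [pairing_orthoPoly_eq_coeff_mul hlam ht hQ'.degree_lt,
    pairing_comm (orthoPoly lam t (n + 1)) P',
    pairing_orthoPoly_right_eq_zero hlam ht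
      (hP'.degree_lt.trans (by exact_mod_cast n.lt_succ_self)), h0, hE,
    pairing_comm _ (X * derivative (orthoPoly lam t n)), pairing_orthoPoly_right_eq_zero hlam ht
      (degree_X_mul_derivative_lt (orthoPoly_degree_lt_succ n))] at h
  have hh := (normSq_pos hlam ht n).ne'
  push_cast at h
  field_simp at h ⊢
  linarith

theorem hasDerivAt_nextCoeff_zero : HasDerivAt (fun s => (orthoPoly lam s 0).nextCoeff) 0 t := by
  simp only [nextCoeff_orthoPoly_zero]
  exact hasDerivAt_const t 0

/-! ### Recurrence coefficients and the entries of the cube of the Jacobi matrix -/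

theorem beta_zero : beta lam 0 t = 0 := rfl

/-- The three-term recurrence relation for all `n`. At `n = 0` the truncated index `n - 1` is
harmless because `β_0 = 0`. -/
theorem recurrence (hlam : -1 < lam) (ht : 0 < t) (n : ℕ) :
    X * orthoPoly lam t n = orthoPoly lam t (n + 1) + C (alpha lam n t) * orthoPoly lam t n +
      C (beta lam n t) * orthoPoly lam t (n - 1) := by
  rcases n with _ | n
  · simpa [beta_zero] using recurrence_zero hlam ht
  · exact recurrence_succ hlam ht n

theorem alpha_eq_nextCoeff_sub (hlam : -1 < lam) (ht : 0 < t) (n : ℕ) :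
    alpha lam n t = (orthoPoly lam t n).nextCoeff - (orthoPoly lam t (n + 1)).nextCoeff := by
  have h := congrArg (fun p => p.coeff n) (recurrence hlam ht n)
  rcases n with _ | n
  · rw [nextCoeff_orthoPoly_succ, nextCoeff_orthoPoly_zero]
    simp [beta_zero, orthoPoly_coeff_self] at h ⊢
    linarith
  · rw [nextCoeff_orthoPoly_succ, nextCoeff_orthoPoly_succ]
    simp only [coeff_X_mul, coeff_add, coeff_C_mul, orthoPoly_coeff_self, Nat.add_sub_cancel,
      orthoPoly_coeff_of_lt n.lt_succ_self] at h
    linarith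

theorem pairing_X_mul_orthoPoly_self (hlam : -1 < lam) (ht : 0 < t) (n : ℕ) :
    pairing lam t (X * orthoPoly lam t n) (orthoPoly lam t n) = alpha lam n t * normSq lam n t :=
  (div_mul_cancel₀ _ (normSq_pos hlam ht n).ne').symm

theorem pairing_X_mul_orthoPoly_succ (hlam : -1 < lam) (ht : 0 < t) (n : ℕ) :
    pairing lam t (X * orthoPoly lam t n) (orthoPoly lam t (n + 1)) = normSq lam (n + 1) t := by
  rw [pairing_orthoPoly_eq_coeff_mul hlam ht, coeff_X_mul, orthoPoly_coeff_self, one_mul]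
  rw [degree_mul, degree_X, orthoPoly_degree]
  exact_mod_cast (by omega : 1 + n < n + 1 + 1)

theorem pairing_X_mul_orthoPoly_pred (hlam : -1 < lam) (ht : 0 < t) (n : ℕ) :
    pairing lam t (X * orthoPoly lam t (n + 1)) (orthoPoly lam t n) = normSq lam (n + 1) t := by
  rw [pairing_X_mul, pairing_comm, pairing_X_mul_orthoPoly_succ hlam ht]

theorem pairing_X_mul_orthoPoly_of_lt (hlam : -1 < lam) (ht : 0 < t) {m n : ℕ} (h : m + 1 < n) :
    pairing lam t (X * orthoPoly lam t m) (orthoPoly lam t n) = 0 := by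
  refine pairing_orthoPoly_right_eq_zero hlam ht ?_
  rw [degree_mul, degree_X, orthoPoly_degree]
  exact_mod_cast (by omega : 1 + m < n)

theorem pairing_X_mul_orthoPoly_of_gt (hlam : -1 < lam) (ht : 0 < t) {m n : ℕ} (h : m + 1 < n) :
    pairing lam t (X * orthoPoly lam t n) (orthoPoly lam t m) = 0 := by
  rw [pairing_X_mul, pairing_comm, pairing_X_mul_orthoPoly_of_lt hlam ht h]

theorem normSq_succ (hlam : -1 < lam) (ht : 0 < t) (n : ℕ) :
    normSq lam (n + 1) t = beta lam ((n : ℤ) + 1) t * normSq lam n t := by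
  rw [← pairing_X_mul_orthoPoly_pred hlam ht]
  exact (div_mul_cancel₀ _ (normSq_pos hlam ht n).ne').symm

theorem pairing_add_left (hlam : -1 < lam) (ht : 0 < t) (p q r : ℝ[X]) :
    pairing lam t (p + q) r = pairing lam t p r + pairing lam t q r := by
  simp only [pairing_eq_momentFunctional, add_mul, momentFunctional_add hlam ht]

theorem pairing_add_right (hlam : -1 < lam) (ht : 0 < t) (p q r : ℝ[X]) :
    pairing lam t p (q + r) = pairing lam t p q + pairing lam t p r := by
  simp only [pairing_eq_momentFunctional, mul_add, momentFunctional_add hlam ht]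

theorem pairing_C_mul_right (a : ℝ) (p q : ℝ[X]) :
    pairing lam t p (C a * q) = a * pairing lam t p q := by
  rw [pairing_comm, pairing_C_mul, pairing_comm]

/-- Splitting `x^3` as `x · x · x` with one factor moved to the right leaves matrix entries of `x`
only, after one use of the recurrence relation on each side. -/
theorem pairing_X_pow_three_mul (p q : ℝ[X]) :
    pairing lam t (X ^ 3 * p) q = pairing lam t (X * (X * p)) (X * q) := by
  simp only [pairing_eq_momentFunctional]
  ring_nf

/-- The diagonal entries of the cube of the Jacobi matrix, scaled by `h_n`. -/
theorem pairing_X_pow_three_self (hlam : -1 < lam) (ht : 0 < t) (n : ℕ) :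
    pairing lam t (X ^ 3 * orthoPoly lam t n) (orthoPoly lam t n) = normSq lam n t *
      (alpha lam n t ^ 3 + 2 * alpha lam n t * (beta lam n t + beta lam ((n : ℤ) + 1) t) +
        alpha lam ((n : ℤ) + 1) t * beta lam ((n : ℤ) + 1) t +
        alpha lam ((n : ℤ) - 1) t * beta lam n t) := by
  rw [pairing_X_pow_three_mul, recurrence hlam ht n]
  simp only [mul_add, mul_left_comm X, pairing_add_left hlam ht, pairing_add_right hlam ht,
    pairing_C_mul, pairing_C_mul_right, pairing_X_mul_orthoPoly_self hlam ht,
    pairing_X_mul_orthoPoly_succ hlam ht, pairing_X_mul_orthoPoly_pred hlam ht]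
  rcases n with _ | n
  · simp only [Nat.cast_zero, beta_zero, normSq_succ hlam ht]
    push_cast
    ring
  · simp only [Nat.add_sub_cancel, pairing_X_mul_orthoPoly_succ hlam ht,
      pairing_X_mul_orthoPoly_pred hlam ht,
      pairing_X_mul_orthoPoly_of_lt hlam ht (show n + 1 < n + 1 + 1 by omega),
      pairing_X_mul_orthoPoly_of_gt hlam ht (show n + 1 < n + 1 + 1 by omega),
      normSq_succ hlam ht]
    push_cast
    rw [add_sub_cancel_right]
    ring

/-- The entries next to the diagonal of the cube of the Jacobi matrix, scaled by `h_n`. -/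
theorem pairing_X_pow_three_succ (hlam : -1 < lam) (ht : 0 < t) (n : ℕ) :
    pairing lam t (X ^ 3 * orthoPoly lam t (n + 1)) (orthoPoly lam t n) = normSq lam n t *
      (beta lam ((n : ℤ) + 1) t * (alpha lam ((n : ℤ) + 1) t ^ 2 +
        alpha lam ((n : ℤ) + 1) t * alpha lam n t + alpha lam n t ^ 2 +
        beta lam ((n : ℤ) + 2) t + beta lam ((n : ℤ) + 1) t + beta lam n t)) := by
  rw [pairing_X_pow_three_mul, recurrence hlam ht n, recurrence hlam ht (n + 1)]
  simp only [mul_add, mul_left_comm X, pairing_add_left hlam ht, pairing_add_right hlam ht,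
    pairing_C_mul, pairing_C_mul_right, Nat.add_sub_cancel, pairing_X_mul_orthoPoly_self hlam ht,
    pairing_X_mul_orthoPoly_succ hlam ht, pairing_X_mul_orthoPoly_pred hlam ht,
    pairing_X_mul_orthoPoly_of_gt hlam ht (show n + 1 < n + 1 + 1 by omega)]
  rcases n with _ | n
  · simp only [Nat.cast_zero, beta_zero, normSq_succ hlam ht]
    push_cast
    norm_num
    ring
  · simp only [Nat.add_sub_cancel, pairing_X_mul_orthoPoly_pred hlam ht,
      pairing_X_mul_orthoPoly_of_gt hlam ht (show n + 1 < n + 1 + 1 by omega),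
      pairing_X_mul_orthoPoly_of_gt hlam ht (show n + 1 < n + 1 + 1 + 1 by omega),
      normSq_succ hlam ht]
    push_cast
    rw [show (n : ℤ) + 2 + 1 = n + 1 + 2 by ring]
    ring

/-! ### The differential-difference equations -/

theorem hasDerivAt_alpha (hlam : -1 < lam) (ht : 0 < t) (n : ℕ) :
    HasDerivAt (alpha lam n) ((alpha lam n t + 3 * beta lam n t * (alpha lam n t ^ 2 +
        alpha lam n t * alpha lam ((n : ℤ) - 1) t + alpha lam ((n : ℤ) - 1) t ^ 2 +
        beta lam n t + beta lam ((n : ℤ) - 1) t) -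
      3 * beta lam ((n : ℤ) + 1) t * (alpha lam ((n : ℤ) + 1) t ^ 2 +
        alpha lam ((n : ℤ) + 1) t * alpha lam n t + alpha lam n t ^ 2 +
        beta lam ((n : ℤ) + 2) t + beta lam ((n : ℤ) + 1) t)) / t) t := by
  have hev : alpha lam n =ᶠ[nhds t] fun s =>
      (orthoPoly lam s n).nextCoeff - (orthoPoly lam s (n + 1)).nextCoeff := by
    filter_upwards [lt_mem_nhds ht] with s hs
    exact alpha_eq_nextCoeff_sub hlam hs n
  have hα := alpha_eq_nextCoeff_sub hlam ht n
  have hh := (normSq_pos hlam ht n).ne'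
  have h1 := hasDerivAt_nextCoeff_succ hlam ht n
  rw [pairing_X_pow_three_succ hlam ht, mul_div_cancel_left₀ _ hh] at h1
  rcases n with _ | n
  · refine ((hasDerivAt_nextCoeff_zero.sub h1).congr_of_eventuallyEq hev).congr_deriv ?_
    rw [nextCoeff_orthoPoly_zero] at hα
    simp only [Nat.cast_zero, beta_zero] at hα ⊢
    rw [hα]
    ring
  · have h2 := hasDerivAt_nextCoeff_succ hlam ht n
    rw [pairing_X_pow_three_succ hlam ht, mul_div_cancel_left₀ _ (normSq_pos hlam ht n).ne'] at h2
    refine ((h2.sub h1).congr_of_eventuallyEq hev).congr_deriv ?_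
    have e1 : ((n + 1 : ℕ) : ℤ) - 1 = n := by push_cast; ring
    have e2 : (n : ℤ) + 1 = (n + 1 : ℕ) := by push_cast; ring
    have e3 : (n : ℤ) + 2 = (n + 1 : ℕ) + 1 := by push_cast; ring
    rw [e1, e2, e3, eq_add_of_sub_eq hα.symm]
    ring

theorem hasDerivAt_beta (hlam : -1 < lam) (ht : 0 < t) (n : ℕ) :
    HasDerivAt (beta lam n) (beta lam n t * (2 +
        3 * alpha lam ((n : ℤ) - 2) t * beta lam ((n : ℤ) - 1) t -
        3 * alpha lam ((n : ℤ) + 1) t * beta lam ((n : ℤ) + 1) t +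
        3 * alpha lam ((n : ℤ) - 1) t * (alpha lam ((n : ℤ) - 1) t ^ 2 + beta lam n t +
          2 * beta lam ((n : ℤ) - 1) t) -
        3 * alpha lam n t * (alpha lam n t ^ 2 + beta lam n t +
          2 * beta lam ((n : ℤ) + 1) t)) / t) t := by
  rcases n with _ | n
  · refine (hasDerivAt_const t (0 : ℝ)).congr_deriv ?_
    simp [beta_zero]
  · have hev : beta lam (n + 1 : ℕ) =ᶠ[nhds t] fun s => normSq lam (n + 1) s / normSq lam n s := by
      filter_upwards [lt_mem_nhds ht] with s hs
      rw [eq_div_iff (normSq_pos hlam hs n).ne', normSq_succ hlam hs]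
      norm_cast
    have hh := (normSq_pos hlam ht n).ne'
    have h1 := hasDerivAt_normSq hlam ht (n + 1)
    have h0 := hasDerivAt_normSq hlam ht n
    refine ((h1.fun_div h0 hh).congr_of_eventuallyEq hev).congr_deriv ?_
    have e1 : ((n + 1 : ℕ) : ℤ) - 1 = n := by push_cast; ring
    have e2 : (n : ℤ) + 1 = (n + 1 : ℕ) := by push_cast; ring
    have e3 : ((n + 1 : ℕ) : ℤ) - 2 = n - 1 := by push_cast; ring
    rw [pairing_X_pow_three_self hlam ht, pairing_X_pow_three_self hlam ht, normSq_succ hlam ht,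
      e1, e2, e3]
    push_cast
    field_simp
    ring

end

end SingularAiry

theorem theorem3p1 (lam : ℝ) (hlam : -1 < lam) (α β : ℤ → ℝ → ℝ)
    (hα : α = SingularAiry.alpha lam) (hβ : β = SingularAiry.beta lam)
    (n : ℤ) (hn : 0 ≤ n) (t : ℝ) (ht : 0 < t) :
    (DifferentiableAt ℝ (α n) t ∧
      t * deriv (α n) t = α n t
        + 3 * β n t * (α n t ^ 2 + α n t * α (n - 1) t + α (n - 1) t ^ 2 + β n t + β (n - 1) t)
        - 3 * β (n + 1) t * (α (n + 1) t ^ 2 + α (n + 1) t * α n t + α n t ^ 2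
            + β (n + 2) t + β (n + 1) t)) ∧
    (DifferentiableAt ℝ (β n) t ∧
      t * deriv (β n) t = β n t *
        (2 + 3 * α (n - 2) t * β (n - 1) t - 3 * α (n + 1) t * β (n + 1) t
          + 3 * α (n - 1) t * (α (n - 1) t ^ 2 + β n t + 2 * β (n - 1) t)
          - 3 * α n t * (α n t ^ 2 + β n t + 2 * β (n + 1) t))) := by
  subst hα hβ
  lift n to ℕ using hn
  have hA := SingularAiry.hasDerivAt_alpha hlam ht n
  have hB := SingularAiry.hasDerivAt_beta hlam ht n
  refine ⟨⟨hA.differentiableAt, ?_⟩, hB.differentiableAt, ?_⟩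
  · rw [hA.deriv, mul_div_cancel₀ _ ht.ne']
  · rw [hB.deriv, mul_div_cancel₀ _ ht.ne']
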